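/- Consider a concurrent zero-sum stochastic game with state space $[n]=\{1,\dots,n\}$, $n\ge 1$. In state $i$, Players Min and Max choose simultaneously actions in nonempty compact Hausdorff spaces $A(i)$ and $B(i)$. The payments $r_i^{ab}\in\mathbb{R}$ made by Min to Max and the transition probabilities $P_{ij}^{ab}\ge 0$, $\sum_{j}P_{ij}^{ab}=1$, depend continuously on $(a,b)\in A(i)\times B(i)$. Let $\Delta_{A(i)}$, $\Delta_{B(i)}$ be the sets of probability measures on $A(i)$, $B(i)$. The Shapley operator $T:\mathbb{R}^n\to\mathbb{R}^n$ of the game is $$T_i(v)=\min_{\alpha\in\Delta_{A(i)}}\max_{\beta\in\Delta_{B(i)}}\int_{A(i)\times B(i)}\Big(r_i^{ab}+\sum_{j}P_{ij}^{ab}v_j\Big)\,d\alpha(a)\,d\beta(b).$$ A pure policy of Min (resp. Max) is an element $\sigma\in\prod_i A(i)$ (resp. $\tau\in\prod_i B(i)$); put $P^{\sigma,\tau}=(P_{ij}^{\sigma(i)\tau(i)})_{i,j}$. The game is unichain (resp. irreducible) if, for all pure policies $\sigma,\tau$, the digraph with an arc $i\to j$ whenever $P^{\sigma,\tau}_{ij}>0$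 has a unique final strongly connected component (resp. is strongly connected). Let $p_{\min}$ be the minimum of all nonzero off-diagonal transition probabilities $P_{ij}^{ab}>0$, $i\ne j$ (with $p_{\min}=1$ if there is none). We assume that this minimum exists, i.e. that the infimum of these numbers is positive; this is automatic when the action spaces are finite. Let $$\theta=\frac{p_{\min}}{1+p_{\min}},\qquad T_\theta=\theta I+(1-\theta)T,\qquad Q^{\sigma,\tau}=\theta I+(1-\theta)P^{\sigma,\tau}.$$ The unichain index $k_{\mathrm{uni}}$ is the smallest integer $k\ge 1$ such that, for all sequences $(\sigma_1,\tau_1),\dots,(\sigma_k,\tau_k)$ of pairs of pure policies and all states $i_1,i_2$, there is a state $j$ such that the entries $(i_1,j)$ and $(i_2,j)$ of $Q^{\sigma_1,\tau_1}\cdots Q^{\sigma_k,\tau_k}$ are both positive. The irreducibility index $k_{\mathrm{irr}}$ is the smallest integer $k\ge 1$ such that all these products of $k$ matrices have only positive entries. Hilbert's seminorm is $\|x\|_{\mathrm H}=\max_i x_i-\min_i x_i$. A map $F:\mathbb{R}^n\to\mathbb{R}^n$ is a contraction of rate at most $\gamma$ in Hilbert's seminorm, where $0\le\gamma<1$, if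 $\|F(x)-F(y)\|_{\mathrm H}\le\gamma\|x-y\|_{\mathrm H}$ for all $x,y$. **Theorem.** If the game is unichain, then $k_{\mathrm{uni}}$ exists and $T_\theta^{k_{\mathrm{uni}}}$ is a contraction in Hilbert's seminorm of rate at most $1-\theta^{k_{\mathrm{uni}}}$. If the game is irreducible, then $k_{\mathrm{irr}}$ exists and $T_\theta^{k_{\mathrm{irr}}}$ is a contraction in Hilbert's seminorm of rate at most $1-n\,\theta^{k_{\mathrm{irr}}}$. -/

import Mathlib

universe u v

noncomputable section

namespace ConcurrentGames

/-- Hilbert's seminorm on `ℝⁿ`: the difference between the top and the bottom coordinate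
(for `n ≥ 1` the supremum and the infimum are a maximum and a minimum). -/
def hilbertSeminorm {n : ℕ} (x : Fin n → ℝ) : ℝ :=
  (⨆ i, x i) - (⨅ i, x i)

/-- `F` is a contraction of rate at most `γ` in Hilbert's seminorm. -/
def IsHilbertContraction {n : ℕ} (γ : ℝ) (F : (Fin n → ℝ) → (Fin n → ℝ)) : Prop :=
  0 ≤ γ ∧ γ < 1 ∧
    ∀ x y, hilbertSeminorm (F x - F y) ≤ γ * hilbertSeminorm (x - y)

section Digraph

/-- There is a (possibly empty) directed path from `i` to `j` in the digraph of `M`, which has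
an arc from `i` to `j` when `M i j > 0`. -/
def Reaches {n : ℕ} (M : Matrix (Fin n) (Fin n) ℝ) (i j : Fin n) : Prop :=
  Relation.ReflTransGen (fun k l => 0 < M k l) i j

/-- Strongly connected components of the digraph of `M`. -/
def IsStronglyConnectedComponent {n : ℕ} (M : Matrix (Fin n) (Fin n) ℝ)
    (C : Set (Fin n)) : Prop :=
  ∃ i, C = {j | Reaches M i j ∧ Reaches M j i}

/-- A set of nodes is final when any path starting from it stays in it. -/
def IsFinalSet {n : ℕ} (M : Matrix (Fin n) (Fin n) ℝ) (C : Set (Fin n)) : Prop :=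
  ∀ i ∈ C, ∀ j, Reaches M i j → j ∈ C

/-- A nonnegative matrix is unichain when its digraph has a unique final strongly connected
component. -/
def IsUnichainMatrix {n : ℕ} (M : Matrix (Fin n) (Fin n) ℝ) : Prop :=
  ∃! C : Set (Fin n), IsStronglyConnectedComponent M C ∧ IsFinalSet M C

end Digraph

/-- The data of a concurrent stochastic game with states `1, …, n`, where in state `i` Player Min
chooses an action in `A i` and Player Max an action in `B i`: instantaneous payments and transition
probabilities, both continuous in the pair of actions. -/
structure ConcurrentGame (n : ℕ) (A : Fin n → Type u) (B : Fin n → Type v)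
    [∀ i, TopologicalSpace (A i)] [∀ i, TopologicalSpace (B i)] where
  /-- The payment made by Min to Max in state `i` under actions `a`, `b`. -/
  payment : ∀ i, A i → B i → ℝ
  /-- `prob i a b j` is the probability of moving from `i` to `j` under actions `a`, `b`. -/
  prob : ∀ i, A i → B i → Fin n → ℝ
  prob_nonneg : ∀ i a b j, 0 ≤ prob i a b j
  prob_sum : ∀ i a b, ∑ j, prob i a b j = 1
  continuous_payment : ∀ i, Continuous fun ab : A i × B i => payment i ab.1 ab.2
  continuous_prob : ∀ i j, Continuous fun ab : A i × B i => prob i ab.1 ab.2 j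

namespace ConcurrentGame

variable {n : ℕ} {A : Fin n → Type u} {B : Fin n → Type v}
  [∀ i, TopologicalSpace (A i)] [∀ i, TopologicalSpace (B i)]

section Shapley

variable [∀ i, MeasurableSpace (A i)] [∀ i, MeasurableSpace (B i)]

/-- The expected payment in state `i` under randomized actions `α`, `β`. -/
def expPayment (G : ConcurrentGame n A B) (i : Fin n)
    (α : MeasureTheory.ProbabilityMeasure (A i))
    (β : MeasureTheory.ProbabilityMeasure (B i)) : ℝ :=
  ∫ a, ∫ b, G.payment i a b ∂(β : MeasureTheory.Measure (B i))
    ∂(α : MeasureTheory.Measure (A i))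

/-- The probability of moving from `i` to `j` under randomized actions `α`, `β`. -/
def expProb (G : ConcurrentGame n A B) (i : Fin n)
    (α : MeasureTheory.ProbabilityMeasure (A i))
    (β : MeasureTheory.ProbabilityMeasure (B i)) (j : Fin n) : ℝ :=
  ∫ a, ∫ b, G.prob i a b j ∂(β : MeasureTheory.Measure (B i))
    ∂(α : MeasureTheory.Measure (A i))

/-- The Shapley operator of the game. The action spaces being compact, the expression is bounded
and the infimum and the supremum are a minimum and a maximum. -/
def shapley (G : ConcurrentGame n A B) (v : Fin n → ℝ) : Fin n → ℝ := fun i =>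
  ⨅ α : MeasureTheory.ProbabilityMeasure (A i), ⨆ β : MeasureTheory.ProbabilityMeasure (B i),
    (G.expPayment i α β + ∑ j, G.expProb i α β j * v j)

end Shapley

/-- The transition matrix of a pair of pure policies. -/
def transition (G : ConcurrentGame n A B) (σ : ∀ i, A i) (τ : ∀ i, B i) :
    Matrix (Fin n) (Fin n) ℝ :=
  Matrix.of fun i j => G.prob i (σ i) (τ i) j

/-- A game is unichain when every pair of pure policies gives a unichain matrix. -/
def IsUnichain (G : ConcurrentGame n A B) : Prop :=
  ∀ (σ : ∀ i, A i) (τ : ∀ i, B i), IsUnichainMatrix (G.transition σ τ)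

/-- A game is irreducible when every pair of pure policies gives an irreducible matrix. -/
def IsIrreducible (G : ConcurrentGame n A B) : Prop :=
  ∀ (σ : ∀ i, A i) (τ : ∀ i, B i), (G.transition σ τ).IsIrreducible

/-- The nonzero off-diagonal transition probabilities of the game. -/
def offDiagProbs (G : ConcurrentGame n A B) : Set ℝ :=
  {p | 0 < p ∧ ∃ i j, i ≠ j ∧ ∃ (a : A i) (b : B i), p = G.prob i a b j}

/-- The smallest nonzero off-diagonal transition probability. All these probabilities are at most
one, so that inserting `1` has no effect but to give the value `1` to the minimum over the empty
set (which occurs for a unichain game with a single state only). The infimum is positive exactly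
when it is a minimum or the set is empty. -/
def pMin (G : ConcurrentGame n A B) : ℝ :=
  sInf (insert 1 G.offDiagProbs)

/-- The damping parameter `θ = p_min / (1 + p_min)`. -/
def theta (G : ConcurrentGame n A B) : ℝ :=
  G.pMin / (1 + G.pMin)

/-- The Krasnoselskii-Mann damped Shapley operator `T_θ = θ I + (1 - θ) T`. -/
def dampedShapley [∀ i, MeasurableSpace (A i)] [∀ i, MeasurableSpace (B i)]
    (G : ConcurrentGame n A B) (x : Fin n → ℝ) : Fin n → ℝ :=
  G.theta • x + (1 - G.theta) • G.shapley x

/-- The damped transition matrix `Q = θ I + (1 - θ) P` of a pair of pure policies. -/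
def dampedTransition (G : ConcurrentGame n A B) (σ : ∀ i, A i) (τ : ∀ i, B i) :
    Matrix (Fin n) (Fin n) ℝ :=
  G.theta • (1 : Matrix (Fin n) (Fin n) ℝ) + (1 - G.theta) • G.transition σ τ

/-- The product `Q₁ ⋯ Q_k` of the damped transition matrices of a sequence of pairs of pure
policies. -/
def dampedProduct (G : ConcurrentGame n A B) {k : ℕ} (σ : Fin k → ∀ i, A i)
    (τ : Fin k → ∀ i, B i) : Matrix (Fin n) (Fin n) ℝ :=
  (List.ofFn fun t => G.dampedTransition (σ t) (τ t)).prod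

/-- The set of states which are accessible from `i` in the product `Q₁ ⋯ Q_k`. -/
def accessible (G : ConcurrentGame n A B) {k : ℕ} (σ : Fin k → ∀ i, A i)
    (τ : Fin k → ∀ i, B i) (i : Fin n) : Set (Fin n) :=
  {j | 0 < G.dampedProduct σ τ i j}

/-- The integers `k ≥ 1` such that, for every sequence of `k` pairs of pure policies, any two
states have a common accessible state. -/
def unichainExponents (G : ConcurrentGame n A B) : Set ℕ :=
  {k | 1 ≤ k ∧ ∀ (σ : Fin k → ∀ i, A i) (τ : Fin k → ∀ i, B i) (i₁ i₂ : Fin n),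
    (G.accessible σ τ i₁ ∩ G.accessible σ τ i₂).Nonempty}

/-- The integers `k ≥ 1` such that every product of `k` damped transition matrices of pairs of pure
policies is entrywise positive. -/
def irreducibleExponents (G : ConcurrentGame n A B) : Set ℕ :=
  {k | 1 ≤ k ∧ ∀ (σ : Fin k → ∀ i, A i) (τ : Fin k → ∀ i, B i) (i j : Fin n),
    0 < G.dampedProduct σ τ i j}

/-- The unichain index of the game. -/
def kUni (G : ConcurrentGame n A B) : ℕ :=
  sInf G.unichainExponents

/-- The irreducibility index of the game. -/
def kIrr (G : ConcurrentGame n A B) : ℕ :=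
  sInf G.irreducibleExponents

end ConcurrentGame

end ConcurrentGames

end

/-!
The damped Shapley operator is compared with damped transition matrices of pure policies. The
difference of two values of the Shapley operator at a state is at most the maximum, over pure
action pairs, of the expectation of `x - y` after one transition (`exists_shapley_sub_le`): the
payments cancel, and an average over randomized actions is at most the maximum over pure ones.
Only monotonicity of the infimum and of the supremum is used here, and no minimax theorem. As the
damped matrices are nonnegative, the comparison iterates: `T_θ^k x - T_θ^k y ≤ M (x - y)` for some
product `M` of `k` damped matrices (`exists_iterate_sub_le`). Exchanging `x` and `y` gives a lower
bound `M' (x - y)` with another product `M'`. Hence `T_θ^k` contracts Hilbert's seminorm as soon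
as any row of `M` and any row of `M'` have a common part of fixed mass
(`isHilbertContraction_iterate`).

The choice of `θ` makes every positive entry of a product of `k` damped matrices at least `θ^k`
(`theta_pow_le_listProduct`), so that only supports matter. In the irreducible case all entries
are positive and the common mass is `n θ^k`. In the unichain case the definition of the index
speaks of two rows of the *same* product, whereas `M` and `M'` differ. While the sets of states
accessible from the two initial states are disjoint, the two sequences of policies can be merged
into one; once the sets meet, they keep meeting, because the damped matrices have a positive
diagonal (`exists_merge`). This yields a common state and the common mass `θ^k`.

The indices exist because `k = n` has the required property. Accessible sets increase; if two of
them stay disjoint in a unichain game, their union grows strictly at every step, since otherwise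
they would be disjoint closed sets and contain distinct final components. In an irreducible game
an accessible set grows strictly until it contains every state.
-/

open MeasureTheory

namespace ConcurrentGames

/-! ### Hilbert's seminorm -/

section HilbertSeminorm

variable {n : ℕ}

theorem hilbertSeminorm_le [Nonempty (Fin n)] {x : Fin n → ℝ} {c : ℝ}
    (h : ∀ i j, x i - x j ≤ c) : hilbertSeminorm x ≤ c := by
  obtain ⟨i, hi⟩ := exists_eq_ciSup_of_finite (f := x)
  obtain ⟨j, hj⟩ := exists_eq_ciInf_of_finite (f := x)
  rw [hilbertSeminorm, ← hi, ← hj]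
  exact h i j

/-- Two probability vectors which share the sub-probability vector `c` average `z` to values that
differ by at most `1 - ∑ c` times the oscillation of `z`: the common part cancels. -/
theorem sum_mul_sub_sum_mul_le {u w c : Fin n → ℝ} (hu : ∑ j, u j = 1) (hw : ∑ j, w j = 1)
    (hcu : ∀ j, c j ≤ u j) (hcw : ∀ j, c j ≤ w j) (z : Fin n → ℝ) :
    ∑ j, u j * z j - ∑ j, w j * z j ≤ (1 - ∑ j, c j) * hilbertSeminorm z := by
  have h1 : ∑ j, (u j - c j) * z j ≤ ∑ j, (u j - c j) * ⨆ i, z i :=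
    Finset.sum_le_sum fun j _ => mul_le_mul_of_nonneg_left
      (le_ciSup (Set.finite_range z).bddAbove j) (sub_nonneg.2 (hcu j))
  have h2 : ∑ j, (w j - c j) * (⨅ i, z i) ≤ ∑ j, (w j - c j) * z j :=
    Finset.sum_le_sum fun j _ => mul_le_mul_of_nonneg_left
      (ciInf_le (Set.finite_range z).bddBelow j) (sub_nonneg.2 (hcw j))
  rw [← Finset.sum_mul, Finset.sum_sub_distrib, hu] at h1
  rw [← Finset.sum_mul, Finset.sum_sub_distrib, hw] at h2
  simp only [sub_mul, Finset.sum_sub_distrib] at h1 h2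
  rw [hilbertSeminorm]
  linarith

end HilbertSeminorm

/-! ### Final components of a digraph -/

/-- A node of `S` that reaches as few nodes as possible lies in a final strongly connected
component. -/
theorem exists_final_component_subset {n : ℕ} {M : Matrix (Fin n) (Fin n) ℝ} {S : Set (Fin n)}
    (hS : S.Nonempty) (hclosed : ∀ i ∈ S, ∀ j, 0 < M i j → j ∈ S) :
    ∃ C ⊆ S, C.Nonempty ∧ IsStronglyConnectedComponent M C ∧ IsFinalSet M C := by
  have hreach : ∀ i ∈ S, ∀ j, Reaches M i j → j ∈ S := by
    intro i hi j hij
    induction hij with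
    | refl => exact hi
    | tail _ h ih => exact hclosed _ ih _ h
  obtain ⟨i, hi, hmin⟩ := Set.exists_min_image S (fun i => {j | Reaches M i j}.ncard)
    S.toFinite hS
  refine ⟨{j | Reaches M i j ∧ Reaches M j i}, fun j hj => hreach i hi j hj.1,
    ⟨i, .refl, .refl⟩, ⟨i, rfl⟩, ?_⟩
  rintro j ⟨hij, -⟩ l hjl
  have hil : Reaches M i l := hij.trans hjl
  have heq : {m | Reaches M l m} = {m | Reaches M i m} :=
    Set.eq_of_subset_of_ncard_le (fun m hm => hil.trans hm) (hmin l (hreach i hi l hil))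
  have : i ∈ {m | Reaches M l m} := heq ▸ Relation.ReflTransGen.refl
  exact ⟨hil, this⟩

theorem IsUnichainMatrix.inter_nonempty {n : ℕ} {M : Matrix (Fin n) (Fin n) ℝ}
    (hM : IsUnichainMatrix M) {S S' : Set (Fin n)} (hS : S.Nonempty) (hS' : S'.Nonempty)
    (hclosed : ∀ i ∈ S, ∀ j, 0 < M i j → j ∈ S) (hclosed' : ∀ i ∈ S', ∀ j, 0 < M i j → j ∈ S') :
    (S ∩ S').Nonempty := by
  obtain ⟨C, hCS, ⟨i, hi⟩, hC⟩ := exists_final_component_subset hS hclosed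
  obtain ⟨C', hCS', -, hC'⟩ := exists_final_component_subset hS' hclosed'
  obtain rfl := hM.unique hC hC'
  exact ⟨i, hCS hi, hCS' hi⟩

theorem _root_.Matrix.IsIrreducible.eq_univ_of_closed {ι : Type*} {M : Matrix ι ι ℝ}
    (hM : M.IsIrreducible) {S : Set ι} (hS : S.Nonempty)
    (hclosed : ∀ i ∈ S, ∀ j, 0 < M i j → j ∈ S) : S = Set.univ := by
  obtain ⟨i, hi⟩ := hS
  refine Set.eq_univ_of_forall fun j => ?_
  let := Matrix.toQuiver M
  obtain ⟨p, -⟩ := hM.connected i j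
  induction p with
  | nil => exact hi
  | cons _ e ih => exact hclosed _ ih _ e.down

/-! ### Iterated integrals over compact spaces -/

/-- The parametric integral of a jointly continuous function over a compact space is continuous:
currying gives a continuous map into the functions on `Y` with the supremum norm, on which the
integral is Lipschitz. No countability of the parameter space is needed. -/
theorem continuous_integral_of_compactSpace {X Y : Type*} [TopologicalSpace X]
    [TopologicalSpace Y] [CompactSpace Y] [MeasurableSpace Y] [BorelSpace Y]
    (μ : Measure Y) [IsProbabilityMeasure μ] {f : X → Y → ℝ}
    (hf : Continuous fun p : X × Y => f p.1 p.2) : Continuous fun x => ∫ y, f x y ∂μ := by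
  have hint : ∀ g : C(Y, ℝ), Integrable g μ := fun g => by
    refine Integrable.of_bound g.continuous.aestronglyMeasurable ‖g‖ (.of_forall fun y => ?_)
    exact g.norm_coe_le_norm y
  have hlip : LipschitzWith 1 fun g : C(Y, ℝ) => ∫ y, g y ∂μ := by
    refine LipschitzWith.of_dist_le_mul fun g h => ?_
    rw [dist_eq_norm, ← integral_sub (hint g) (hint h)]
    refine (norm_integral_le_of_norm_le_const (C := dist g h) (.of_forall fun y => ?_)).trans ?_
    · rw [← dist_eq_norm]
      exact ContinuousMap.dist_apply_le_dist y
    · simp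
  exact hlip.continuous.comp (ContinuousMap.curry ⟨_, hf⟩).continuous

section Integrals

variable {X Y : Type*} [TopologicalSpace X] [CompactSpace X] [MeasurableSpace X] [BorelSpace X]
  [TopologicalSpace Y] [CompactSpace Y] [MeasurableSpace Y] [BorelSpace Y]

theorem integrable_of_continuous_compactSpace (μ : Measure X) [IsProbabilityMeasure μ]
    {f : X → ℝ} (hf : Continuous f) : Integrable f μ :=
  Integrable.of_bound hf.aestronglyMeasurable ‖(⟨f, hf⟩ : C(X, ℝ))‖
    (.of_forall (ContinuousMap.norm_coe_le_norm ⟨f, hf⟩))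

theorem integral_integral_le_of_le (μ : Measure X) [IsProbabilityMeasure μ] (ν : Measure Y)
    [IsProbabilityMeasure ν] {f : X → Y → ℝ} (hf : Continuous fun p : X × Y => f p.1 p.2) {m : ℝ}
    (h : ∀ x y, f x y ≤ m) : ∫ x, ∫ y, f x y ∂ν ∂μ ≤ m := by
  have h1 : ∀ x, ∫ y, f x y ∂ν ≤ m := fun x => by
    simpa using integral_mono (integrable_of_continuous_compactSpace ν
      (hf.comp (Continuous.prodMk_right x))) (integrable_const m) (h x)
  simpa using integral_mono (integrable_of_continuous_compactSpace μ
    (continuous_integral_of_compactSpace ν hf)) (integrable_const m) h1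

theorem integral_integral_sum_mul (μ : Measure X) [IsProbabilityMeasure μ] (ν : Measure Y)
    [IsProbabilityMeasure ν] {ι : Type*} [Fintype ι] {f : ι → X → Y → ℝ}
    (hf : ∀ j, Continuous fun p : X × Y => f j p.1 p.2) (z : ι → ℝ) :
    ∫ x, ∫ y, ∑ j, f j x y * z j ∂ν ∂μ = ∑ j, (∫ x, ∫ y, f j x y ∂ν ∂μ) * z j := by
  have h1 : ∀ x, ∫ y, ∑ j, f j x y * z j ∂ν = ∑ j, (∫ y, f j x y ∂ν) * z j := fun x => by
    have hint : ∀ j, Integrable (f j x) ν := fun j =>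
      integrable_of_continuous_compactSpace ν ((hf j).comp (Continuous.prodMk_right x))
    rw [integral_finsetSum _ fun j _ => (hint j).mul_const _]
    exact Finset.sum_congr rfl fun j _ => integral_mul_const _ _
  simp_rw [h1]
  rw [integral_finsetSum _ fun j _ => (integrable_of_continuous_compactSpace μ
    (continuous_integral_of_compactSpace ν (hf j))).mul_const _]
  exact Finset.sum_congr rfl fun j _ => integral_mul_const _ _

end Integrals

namespace ConcurrentGame

variable {n : ℕ} {A : Fin n → Type u} {B : Fin n → Type v}
  [∀ i, TopologicalSpace (A i)] [∀ i, TopologicalSpace (B i)]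

/-! ### Comparison of values of the Shapley operator -/

section Comparison

variable [∀ i, CompactSpace (A i)] [∀ i, MeasurableSpace (A i)] [∀ i, CompactSpace (B i)]
  [∀ i, MeasurableSpace (B i)]

/-- The expected one-day payoff, on which the minimax in the Shapley operator is taken, is bounded
uniformly in the randomized actions. -/
theorem exists_abs_payoff_le (G : ConcurrentGame n A B) (i : Fin n) (x : Fin n → ℝ) :
    ∃ C, ∀ (α : ProbabilityMeasure (A i)) (β : ProbabilityMeasure (B i)),
      |G.expPayment i α β + ∑ j, G.expProb i α β j * x j| ≤ C := by
  have hbound : ∀ f : A i → B i → ℝ, (Continuous fun p : A i × B i => f p.1 p.2) →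
      ∃ C, ∀ (α : ProbabilityMeasure (A i)) (β : ProbabilityMeasure (B i)),
        |∫ a, ∫ b, f a b ∂(β : Measure (B i)) ∂(α : Measure (A i))| ≤ C := by
    intro f hf
    obtain ⟨C, hC⟩ := isCompact_univ.exists_bound_of_continuousOn hf.continuousOn
    refine ⟨C, fun α β => ?_⟩
    have h1 : ∀ a, ‖∫ b, f a b ∂(β : Measure (B i))‖ ≤ C := fun a => by
      simpa using norm_integral_le_of_norm_le_const (μ := (β : Measure (B i)))
        (.of_forall fun b => hC (a, b) trivial)
    simpa using norm_integral_le_of_norm_le_const (μ := (α : Measure (A i))) (.of_forall h1)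
  obtain ⟨C, hC⟩ := hbound _ (G.continuous_payment i)
  choose D hD using fun j => hbound (fun a b => G.prob i a b j) (G.continuous_prob i j)
  refine ⟨C + ∑ j, D j * |x j|, fun α β => (abs_add_le _ _).trans (add_le_add (hC α β) ?_)⟩
  refine (Finset.abs_sum_le_sum_abs _ _).trans (Finset.sum_le_sum fun j _ => ?_)
  rw [abs_mul]
  exact mul_le_mul_of_nonneg_right (hD j α β) (abs_nonneg _)

variable [∀ i, Nonempty (A i)] [∀ i, BorelSpace (A i)] [∀ i, Nonempty (B i)]
  [∀ i, BorelSpace (B i)]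

/-- A pure action pair maximizing the expectation of `x - y` after one transition bounds the
increase of the value from `y` to `x`; the payments cancel. -/
theorem exists_shapley_sub_le (G : ConcurrentGame n A B) (x y : Fin n → ℝ) :
    ∃ (σ : ∀ i, A i) (τ : ∀ i, B i), ∀ i,
      G.shapley x i - G.shapley y i ≤ ∑ j, G.transition σ τ i j * (x j - y j) := by
  have hcont : ∀ i, Continuous fun p : A i × B i => ∑ j, G.prob i p.1 p.2 j * (x j - y j) :=
    fun i => continuous_finsetSum _ fun j _ => (G.continuous_prob i j).mul continuous_const
  have hmax : ∀ i, ∃ p : A i × B i, ∀ q : A i × B i,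
      ∑ j, G.prob i q.1 q.2 j * (x j - y j) ≤ ∑ j, G.prob i p.1 p.2 j * (x j - y j) := fun i => by
    obtain ⟨p, -, hp⟩ := isCompact_univ.exists_isMaxOn Set.univ_nonempty (hcont i).continuousOn
    exact ⟨p, fun q => hp (Set.mem_univ q)⟩
  choose p hp using hmax
  refine ⟨fun i => (p i).1, fun i => (p i).2, fun i => ?_⟩
  set m := ∑ j, G.prob i (p i).1 (p i).2 j * (x j - y j) with hm
  change G.shapley x i - G.shapley y i ≤ m
  have hle : ∀ (α : ProbabilityMeasure (A i)) (β : ProbabilityMeasure (B i)),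
      G.expPayment i α β + ∑ j, G.expProb i α β j * x j ≤
        G.expPayment i α β + ∑ j, G.expProb i α β j * y j + m := by
    intro α β
    have h1 : ∑ j, G.expProb i α β j * (x j - y j) ≤ m := by
      have h2 := integral_integral_sum_mul (α : Measure (A i)) (β : Measure (B i))
        (f := fun j a b => G.prob i a b j) (G.continuous_prob i) (x - y)
      simp only [Pi.sub_apply] at h2
      simp only [expProb]
      rw [← h2]
      exact integral_integral_le_of_le _ _ (hcont i) fun a b => hp i (a, b)
    simp only [mul_sub, Finset.sum_sub_distrib] at h1
    linarith
  obtain ⟨Cx, hCx⟩ := G.exists_abs_payoff_le i x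
  obtain ⟨Cy, hCy⟩ := G.exists_abs_payoff_le i y
  have : Nonempty (ProbabilityMeasure (A i)) :=
    ⟨⟨Measure.dirac (Classical.arbitrary _), inferInstance⟩⟩
  let β₀ : ProbabilityMeasure (B i) := ⟨Measure.dirac (Classical.arbitrary _), inferInstance⟩
  have : Nonempty (ProbabilityMeasure (B i)) := ⟨β₀⟩
  have bdd : ∀ {z : Fin n → ℝ} {C : ℝ}, (∀ (α : ProbabilityMeasure (A i))
      (β : ProbabilityMeasure (B i)),
      |G.expPayment i α β + ∑ j, G.expProb i α β j * z j| ≤ C) → ∀ α : ProbabilityMeasure (A i),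
      BddAbove (Set.range fun β : ProbabilityMeasure (B i) =>
        G.expPayment i α β + ∑ j, G.expProb i α β j * z j) := by
    rintro z C h α
    refine ⟨C, ?_⟩
    rintro _ ⟨β, rfl⟩
    exact (abs_le.1 (h α β)).2
  rw [sub_le_iff_le_add', ← sub_le_iff_le_add]
  refine le_ciInf fun α => ?_
  rw [sub_le_iff_le_add]
  -- On `ℝ`, monotonicity of the infimum and of the supremum needs the boundedness shown above.
  refine (ciInf_le ⟨-Cx, ?_⟩ α).trans (ciSup_le fun β => (hle α β).trans ?_)
  · rintro _ ⟨α', rfl⟩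
    exact (abs_le.1 (hCx α' β₀)).1.trans (le_ciSup (bdd hCx α') β₀)
  · exact add_le_add (le_ciSup (bdd hCy α) β) le_rfl

end Comparison

/-! ### Damped transition matrices -/

theorem transition_nonneg (G : ConcurrentGame n A B) (σ : ∀ i, A i) (τ : ∀ i, B i)
    (i j : Fin n) : 0 ≤ G.transition σ τ i j :=
  G.prob_nonneg i _ _ j

theorem bddBelow_insert_offDiagProbs (G : ConcurrentGame n A B) :
    BddBelow (insert 1 G.offDiagProbs) := by
  refine ⟨0, ?_⟩
  rintro p (rfl | hp)
  · exact zero_le_one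
  · exact hp.1.le

theorem theta_pos (G : ConcurrentGame n A B) (hp : 0 < G.pMin) : 0 < G.theta :=
  div_pos hp (by linarith)

theorem one_sub_theta_mul_pMin (G : ConcurrentGame n A B) (hp : 0 < G.pMin) :
    (1 - G.theta) * G.pMin = G.theta := by
  have : 1 + G.pMin ≠ 0 := by linarith
  rw [theta]
  field_simp
  ring

theorem one_sub_theta_pos (G : ConcurrentGame n A B) (hp : 0 < G.pMin) : 0 < 1 - G.theta :=
  pos_of_mul_pos_left (by rw [G.one_sub_theta_mul_pMin hp]; exact G.theta_pos hp) hp.le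

theorem dampedTransition_apply (G : ConcurrentGame n A B) (σ : ∀ i, A i) (τ : ∀ i, B i)
    (i j : Fin n) : G.dampedTransition σ τ i j =
      G.theta * (if i = j then 1 else 0) + (1 - G.theta) * G.transition σ τ i j := by
  simp [dampedTransition, Matrix.one_apply]

theorem dampedTransition_nonneg (G : ConcurrentGame n A B) (hp : 0 < G.pMin) (σ : ∀ i, A i)
    (τ : ∀ i, B i) (i j : Fin n) : 0 ≤ G.dampedTransition σ τ i j := by
  rw [dampedTransition_apply]
  have := mul_nonneg (G.one_sub_theta_pos hp).le (G.transition_nonneg σ τ i j)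
  have := G.theta_pos hp
  split_ifs <;> linarith

theorem dampedTransition_sum (G : ConcurrentGame n A B) (σ : ∀ i, A i) (τ : ∀ i, B i)
    (i : Fin n) : ∑ j, G.dampedTransition σ τ i j = 1 := by
  simp only [dampedTransition_apply, Finset.sum_add_distrib, ← Finset.mul_sum]
  simp [transition, G.prob_sum]

theorem dampedTransition_self_pos (G : ConcurrentGame n A B) (hp : 0 < G.pMin) (σ : ∀ i, A i)
    (τ : ∀ i, B i) (i : Fin n) : 0 < G.dampedTransition σ τ i i := by
  rw [dampedTransition_apply, if_pos rfl, mul_one]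
  exact add_pos_of_pos_of_nonneg (G.theta_pos hp)
    (mul_nonneg (G.one_sub_theta_pos hp).le (G.transition_nonneg σ τ i i))

theorem dampedTransition_pos_of_transition_pos (G : ConcurrentGame n A B) (hp : 0 < G.pMin)
    {σ : ∀ i, A i} {τ : ∀ i, B i} {i j : Fin n} (h : 0 < G.transition σ τ i j) :
    0 < G.dampedTransition σ τ i j := by
  rw [dampedTransition_apply]
  refine add_pos_of_nonneg_of_pos (mul_nonneg (G.theta_pos hp).le ?_)
    (mul_pos (G.one_sub_theta_pos hp) h)
  split_ifs <;> norm_num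

/-- The value of `θ` equalizes the bounds on the two kinds of positive entries: `θ` on the
diagonal and `(1 - θ) p_min = θ` off it. -/
theorem theta_le_dampedTransition (G : ConcurrentGame n A B) (hp : 0 < G.pMin) {σ : ∀ i, A i}
    {τ : ∀ i, B i} {i j : Fin n} (h : 0 < G.dampedTransition σ τ i j) :
    G.theta ≤ G.dampedTransition σ τ i j := by
  rw [dampedTransition_apply] at h ⊢
  have h1 := G.one_sub_theta_pos hp
  split_ifs at h ⊢ with hij
  · have := mul_nonneg h1.le (G.transition_nonneg σ τ i j)
    linarith
  · rw [mul_zero, zero_add] at h ⊢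
    have hpos : 0 < G.transition σ τ i j := pos_of_mul_pos_right h h1.le
    have hmin : G.pMin ≤ G.transition σ τ i j :=
      csInf_le G.bddBelow_insert_offDiagProbs (Or.inr ⟨hpos, i, j, hij, _, _, rfl⟩)
    calc G.theta = (1 - G.theta) * G.pMin := (G.one_sub_theta_mul_pMin hp).symm
      _ ≤ _ := mul_le_mul_of_nonneg_left hmin h1.le

/-! ### Products of damped transition matrices -/

/-- The product of the damped transition matrices along a list of pairs of pure policies. -/
noncomputable def listProduct (G : ConcurrentGame n A B) (L : List ((∀ i, A i) × (∀ i, B i))) :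
    Matrix (Fin n) (Fin n) ℝ :=
  (L.map fun p => G.dampedTransition p.1 p.2).prod

theorem listProduct_cons_apply (G : ConcurrentGame n A B) (p : (∀ i, A i) × (∀ i, B i))
    (L : List ((∀ i, A i) × (∀ i, B i))) (i j : Fin n) :
    G.listProduct (p :: L) i j =
      ∑ l, G.dampedTransition p.1 p.2 i l * G.listProduct L l j := by
  simp [listProduct, Matrix.mul_apply]

theorem dampedProduct_eq_listProduct (G : ConcurrentGame n A B) {k : ℕ} (σ : Fin k → ∀ i, A i)
    (τ : Fin k → ∀ i, B i) :
    G.dampedProduct σ τ = G.listProduct (List.ofFn fun t => (σ t, τ t)) := by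
  simp [dampedProduct, listProduct, List.map_ofFn, Function.comp_def]

theorem listProduct_eq_dampedProduct (G : ConcurrentGame n A B)
    (L : List ((∀ i, A i) × (∀ i, B i))) :
    G.listProduct L =
      G.dampedProduct (fun t : Fin L.length => (L.get t).1) fun t => (L.get t).2 := by
  rw [dampedProduct_eq_listProduct]
  simp

theorem listProduct_nonneg (G : ConcurrentGame n A B) (hp : 0 < G.pMin)
    (L : List ((∀ i, A i) × (∀ i, B i))) (i j : Fin n) : 0 ≤ G.listProduct L i j := by
  induction L generalizing i with
  | nil => rw [listProduct, List.map_nil, List.prod_nil, Matrix.one_apply]; split_ifs <;> norm_num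
  | cons p L ih =>
    rw [listProduct_cons_apply]
    exact Finset.sum_nonneg fun l _ => mul_nonneg (G.dampedTransition_nonneg hp _ _ _ _) (ih l)

theorem listProduct_sum (G : ConcurrentGame n A B) (L : List ((∀ i, A i) × (∀ i, B i)))
    (i : Fin n) : ∑ j, G.listProduct L i j = 1 := by
  induction L generalizing i with
  | nil => simp [listProduct, Matrix.one_apply]
  | cons p L ih =>
    simp_rw [listProduct_cons_apply]
    rw [Finset.sum_comm]
    simp_rw [← Finset.mul_sum, ih, mul_one, dampedTransition_sum]

theorem listProduct_cons_pos_iff (G : ConcurrentGame n A B) (hp : 0 < G.pMin)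
    (p : (∀ i, A i) × (∀ i, B i)) (L : List ((∀ i, A i) × (∀ i, B i))) (i j : Fin n) :
    0 < G.listProduct (p :: L) i j ↔
      ∃ l, 0 < G.dampedTransition p.1 p.2 i l ∧ 0 < G.listProduct L l j := by
  have hQ := G.dampedTransition_nonneg hp p.1 p.2 i
  have hL := fun l => G.listProduct_nonneg hp L l j
  rw [listProduct_cons_apply, Finset.sum_pos_iff_of_nonneg fun l _ => mul_nonneg (hQ l) (hL l)]
  simp only [Finset.mem_univ, true_and]
  refine exists_congr fun l => ⟨fun h => ?_, fun h => mul_pos h.1 h.2⟩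
  exact ⟨pos_of_mul_pos_left h (hL l), pos_of_mul_pos_right h (hQ l)⟩

theorem theta_pow_le_listProduct (G : ConcurrentGame n A B) (hp : 0 < G.pMin)
    (L : List ((∀ i, A i) × (∀ i, B i))) {i j : Fin n} (h : 0 < G.listProduct L i j) :
    G.theta ^ L.length ≤ G.listProduct L i j := by
  induction L generalizing i with
  | nil =>
    simp only [listProduct, List.map_nil, List.prod_nil, Matrix.one_apply] at h ⊢
    split_ifs at h ⊢ <;> simp_all
  | cons p L ih =>
    obtain ⟨l, hl, hl'⟩ := (G.listProduct_cons_pos_iff hp p L i j).1 h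
    rw [listProduct_cons_apply, List.length_cons, pow_succ']
    calc G.theta * G.theta ^ L.length
        ≤ G.dampedTransition p.1 p.2 i l * G.listProduct L l j :=
          mul_le_mul (G.theta_le_dampedTransition hp hl) (ih hl')
            (pow_nonneg (G.theta_pos hp).le _) hl.le
      _ ≤ _ := Finset.single_le_sum (f := fun l => G.dampedTransition p.1 p.2 i l *
            G.listProduct L l j) (fun l _ => mul_nonneg (G.dampedTransition_nonneg hp _ _ _ _)
            (G.listProduct_nonneg hp _ _ _)) (Finset.mem_univ l)

/-! ### Accessibility along lists of policies -/

/-- The states accessible from `S` in one step of the damped chain of the policies `p`. -/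
def successors (G : ConcurrentGame n A B) (p : (∀ i, A i) × (∀ i, B i)) (S : Set (Fin n)) :
    Set (Fin n) :=
  {j | ∃ i ∈ S, 0 < G.dampedTransition p.1 p.2 i j}

/-- The states accessible from `S` when the policies of `L` are used one after the other. -/
def accessibleFrom (G : ConcurrentGame n A B) (L : List ((∀ i, A i) × (∀ i, B i)))
    (S : Set (Fin n)) : Set (Fin n) :=
  L.foldl (fun S p => G.successors p S) S

theorem mem_accessibleFrom (G : ConcurrentGame n A B) (hp : 0 < G.pMin)
    (L : List ((∀ i, A i) × (∀ i, B i))) (S : Set (Fin n)) (j : Fin n) :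
    j ∈ G.accessibleFrom L S ↔ ∃ i ∈ S, 0 < G.listProduct L i j := by
  induction L generalizing S with
  | nil =>
    simp only [accessibleFrom, List.foldl_nil, listProduct, List.map_nil, List.prod_nil,
      Matrix.one_apply]
    refine ⟨fun h => ⟨j, h, by simp⟩, ?_⟩
    rintro ⟨i, hi, h⟩
    split_ifs at h with hij
    · exact hij ▸ hi
    · exact absurd h (lt_irrefl _)
  | cons p L ih =>
    simp only [listProduct_cons_pos_iff G hp]
    refine (ih (G.successors p S)).trans ⟨?_, ?_⟩
    · rintro ⟨l, ⟨i, hi, h1⟩, h2⟩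
      exact ⟨i, hi, l, h1, h2⟩
    · rintro ⟨i, hi, l, h1, h2⟩
      exact ⟨l, ⟨i, hi, h1⟩, h2⟩

theorem mem_accessibleFrom_singleton (G : ConcurrentGame n A B) (hp : 0 < G.pMin)
    (L : List ((∀ i, A i) × (∀ i, B i))) (i j : Fin n) :
    j ∈ G.accessibleFrom L {i} ↔ 0 < G.listProduct L i j := by
  simp [G.mem_accessibleFrom hp]

theorem subset_successors (G : ConcurrentGame n A B) (hp : 0 < G.pMin)
    (p : (∀ i, A i) × (∀ i, B i)) (S : Set (Fin n)) : S ⊆ G.successors p S :=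
  fun i hi => ⟨i, hi, G.dampedTransition_self_pos hp _ _ i⟩

theorem subset_accessibleFrom (G : ConcurrentGame n A B) (hp : 0 < G.pMin)
    (L : List ((∀ i, A i) × (∀ i, B i))) (S : Set (Fin n)) : S ⊆ G.accessibleFrom L S := by
  induction L generalizing S with
  | nil => exact subset_rfl
  | cons p L ih => exact (G.subset_successors hp p S).trans (ih _)

theorem closed_of_successors_subset (G : ConcurrentGame n A B) (hp : 0 < G.pMin)
    {p : (∀ i, A i) × (∀ i, B i)} {S : Set (Fin n)} (h : G.successors p S ⊆ S) :
    ∀ i ∈ S, ∀ j, 0 < G.transition p.1 p.2 i j → j ∈ S :=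
  fun i hi _ hij => h ⟨i, hi, G.dampedTransition_pos_of_transition_pos hp hij⟩

theorem successors_congr (G : ConcurrentGame n A B) {p q : (∀ i, A i) × (∀ i, B i)}
    {S : Set (Fin n)} (h : ∀ i ∈ S, p.1 i = q.1 i ∧ p.2 i = q.2 i) :
    G.successors p S = G.successors q S := by
  have key : ∀ i ∈ S, ∀ j,
      G.dampedTransition p.1 p.2 i j = G.dampedTransition q.1 q.2 i j := fun i hi j => by
    simp only [dampedTransition_apply, transition, Matrix.of_apply, (h i hi).1, (h i hi).2]
  ext j
  exact exists_congr fun i => and_congr_right fun hi => by rw [key i hi j]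

/-- As long as the states accessible under two lists of policies are disjoint, the lists can be
merged into one: the policies of `L` are used on the states accessible from `S`, and those of `L'`
elsewhere. A state common to both accessible sets at some time stays common afterwards. -/
theorem exists_merge (G : ConcurrentGame n A B) (hp : 0 < G.pMin)
    (L L' : List ((∀ i, A i) × (∀ i, B i))) (hL : L.length = L'.length) (S S' : Set (Fin n)) :
    (G.accessibleFrom L S ∩ G.accessibleFrom L' S').Nonempty ∨
      ∃ L'' : List ((∀ i, A i) × (∀ i, B i)), L''.length = L.length ∧
        G.accessibleFrom L'' S = G.accessibleFrom L S ∧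
        G.accessibleFrom L'' S' = G.accessibleFrom L' S' := by
  classical
  induction L generalizing L' S S' with
  | nil =>
    obtain rfl : L' = [] := List.length_eq_zero_iff.1 hL.symm
    exact Or.inr ⟨[], rfl, rfl, rfl⟩
  | cons p L ih =>
    obtain - | ⟨p', L'⟩ := L'
    · simp at hL
    by_cases hSS : (S ∩ S').Nonempty
    · exact Or.inl (hSS.mono (Set.inter_subset_inter (G.subset_accessibleFrom hp _ _)
        (G.subset_accessibleFrom hp _ _)))
    let q : (∀ i, A i) × (∀ i, B i) :=
      (fun i => if i ∈ S then p.1 i else p'.1 i, fun i => if i ∈ S then p.2 i else p'.2 i)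
    have hq : G.successors q S = G.successors p S :=
      G.successors_congr fun i hi => ⟨if_pos hi, if_pos hi⟩
    have hq' : G.successors q S' = G.successors p' S' :=
      G.successors_congr fun i hi =>
        have hi' : i ∉ S := fun h => hSS ⟨i, h, hi⟩
        ⟨if_neg hi', if_neg hi'⟩
    refine (ih L' (by simpa using hL) (G.successors p S) (G.successors p' S')).imp id ?_
    rintro ⟨L'', h0, h1, h2⟩
    refine ⟨q :: L'', by simp [h0], ?_, ?_⟩
    · rw [← hq] at h1
      simp only [accessibleFrom, List.foldl_cons] at h1 ⊢
      rw [h1, hq]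
    · rw [← hq'] at h2
      simp only [accessibleFrom, List.foldl_cons] at h2 ⊢
      rw [h2, hq']

/-! ### Existence of the indices -/

theorem ncard_le_of_fin (S : Set (Fin n)) : S.ncard ≤ n := by
  simpa using Set.ncard_le_ncard (Set.subset_univ S)

/-- In a unichain game, two accessible sets which stay disjoint cannot both be closed, so that
their union grows at every step. -/
theorem IsUnichain.length_add_ncard_le {G : ConcurrentGame n A B} (hG : G.IsUnichain)
    (hp : 0 < G.pMin) (L : List ((∀ i, A i) × (∀ i, B i))) {S S' : Set (Fin n)}
    (hS : S.Nonempty) (hS' : S'.Nonempty)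
    (h : ¬ (G.accessibleFrom L S ∩ G.accessibleFrom L S').Nonempty) :
    L.length + (S ∪ S').ncard ≤ n := by
  induction L generalizing S S' with
  | nil => simpa using ncard_le_of_fin (S ∪ S')
  | cons p L ih =>
    have hsub := G.subset_successors hp p S
    have hsub' := G.subset_successors hp p S'
    have hlt : (S ∪ S').ncard < (G.successors p S ∪ G.successors p S').ncard := by
      refine Set.ncard_lt_ncard ⟨Set.union_subset_union hsub hsub', fun hle => ?_⟩
      have hdis : ∀ i, i ∈ G.successors p S → i ∈ G.successors p S' → False := fun i hi hi' =>
        h ⟨i, G.subset_accessibleFrom hp L _ hi, G.subset_accessibleFrom hp L _ hi'⟩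
      have hc : G.successors p S ⊆ S := fun i hi =>
        (hle (Or.inl hi)).resolve_right fun hi' => hdis i hi (hsub' hi')
      have hc' : G.successors p S' ⊆ S' := fun i hi =>
        (hle (Or.inr hi)).resolve_left fun hi' => hdis i (hsub hi') hi
      obtain ⟨i, hi, hi'⟩ := (hG p.1 p.2).inter_nonempty hS hS'
        (G.closed_of_successors_subset hp hc) (G.closed_of_successors_subset hp hc')
      exact hdis i (hsub hi) (hsub' hi')
    have := ih (hS.mono hsub) (hS'.mono hsub') h
    rw [List.length_cons]
    omega

theorem IsIrreducible.length_add_ncard_le {G : ConcurrentGame n A B} (hG : G.IsIrreducible)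
    (hp : 0 < G.pMin) (L : List ((∀ i, A i) × (∀ i, B i))) {S : Set (Fin n)}
    (hS : S.Nonempty) (h : G.accessibleFrom L S ≠ Set.univ) : L.length + S.ncard ≤ n := by
  induction L generalizing S with
  | nil => simpa using ncard_le_of_fin S
  | cons p L ih =>
    have hsub := G.subset_successors hp p S
    have hlt : S.ncard < (G.successors p S).ncard := by
      refine Set.ncard_lt_ncard ⟨hsub, fun hle => h (Set.univ_subset_iff.1 ?_)⟩
      have huniv := (hG p.1 p.2).eq_univ_of_closed hS (G.closed_of_successors_subset hp hle)
      rw [← huniv]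
      exact G.subset_accessibleFrom hp _ _
    have := ih (hS.mono hsub) h
    rw [List.length_cons]
    omega

theorem IsUnichain.kUni_mem {G : ConcurrentGame n A B} (hG : G.IsUnichain) (hn : 1 ≤ n)
    (hp : 0 < G.pMin) : G.kUni ∈ G.unichainExponents := by
  refine Nat.sInf_mem ⟨n, hn, fun σ τ i₁ i₂ => ?_⟩
  have hacc : ∀ i, G.accessible σ τ i = G.accessibleFrom (List.ofFn fun t => (σ t, τ t)) {i} :=
    fun i => Set.ext fun j => by
      rw [G.mem_accessibleFrom_singleton hp, ← dampedProduct_eq_listProduct]; rfl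
  rw [hacc, hacc]
  by_contra h
  have h1 := hG.length_add_ncard_le hp _ (Set.singleton_nonempty i₁) (Set.singleton_nonempty i₂) h
  have h2 : 0 < ({i₁} ∪ {i₂} : Set (Fin n)).ncard := by
    rw [Set.ncard_pos]
    exact ⟨i₁, Or.inl rfl⟩
  rw [List.length_ofFn] at h1
  omega

theorem IsIrreducible.kIrr_mem {G : ConcurrentGame n A B} (hG : G.IsIrreducible) (hn : 1 ≤ n)
    (hp : 0 < G.pMin) : G.kIrr ∈ G.irreducibleExponents := by
  refine Nat.sInf_mem ⟨n, hn, fun σ τ i j => ?_⟩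
  rw [dampedProduct_eq_listProduct, ← G.mem_accessibleFrom_singleton hp]
  by_contra h
  have h1 := hG.length_add_ncard_le hp _ (Set.singleton_nonempty i)
    fun huniv => h (huniv ▸ Set.mem_univ j)
  rw [List.length_ofFn, Set.ncard_singleton] at h1
  omega

/-! ### Contraction of the iterates -/

section Contraction

variable [∀ i, CompactSpace (A i)] [∀ i, Nonempty (A i)] [∀ i, MeasurableSpace (A i)]
  [∀ i, BorelSpace (A i)] [∀ i, CompactSpace (B i)] [∀ i, Nonempty (B i)]
  [∀ i, MeasurableSpace (B i)] [∀ i, BorelSpace (B i)]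

theorem exists_dampedShapley_sub_le (G : ConcurrentGame n A B) (hp : 0 < G.pMin)
    (x y : Fin n → ℝ) : ∃ p : (∀ i, A i) × (∀ i, B i), ∀ i,
      G.dampedShapley x i - G.dampedShapley y i ≤
        ∑ j, G.dampedTransition p.1 p.2 i j * (x j - y j) := by
  obtain ⟨σ, τ, h⟩ := G.exists_shapley_sub_le x y
  refine ⟨(σ, τ), fun i => ?_⟩
  have h1 := mul_le_mul_of_nonneg_left (h i) (G.one_sub_theta_pos hp).le
  have h2 : ∑ j, G.dampedTransition σ τ i j * (x j - y j) = G.theta * (x i - y i) +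
      (1 - G.theta) * ∑ j, G.transition σ τ i j * (x j - y j) := by
    simp_rw [dampedTransition_apply, add_mul, Finset.sum_add_distrib, Finset.mul_sum, mul_assoc]
    simp
  rw [h2]
  simp only [dampedShapley, Pi.add_apply, Pi.smul_apply, smul_eq_mul]
  linarith

theorem exists_iterate_sub_le (G : ConcurrentGame n A B) (hp : 0 < G.pMin) (k : ℕ)
    (x y : Fin n → ℝ) : ∃ L : List ((∀ i, A i) × (∀ i, B i)), L.length = k ∧ ∀ i,
      G.dampedShapley^[k] x i - G.dampedShapley^[k] y i ≤
        ∑ j, G.listProduct L i j * (x j - y j) := by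
  induction k with
  | zero => exact ⟨[], rfl, fun i => by simp [listProduct, Matrix.one_apply]⟩
  | succ k ih =>
    obtain ⟨L, hL, h⟩ := ih
    obtain ⟨p, h'⟩ := G.exists_dampedShapley_sub_le hp (G.dampedShapley^[k] x)
      (G.dampedShapley^[k] y)
    refine ⟨p :: L, by simp [hL], fun i => ?_⟩
    rw [Function.iterate_succ_apply', Function.iterate_succ_apply']
    calc _ ≤ _ := h' i
      _ ≤ ∑ l, G.dampedTransition p.1 p.2 i l * ∑ j, G.listProduct L l j * (x j - y j) :=
        Finset.sum_le_sum fun l _ =>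
          mul_le_mul_of_nonneg_left (h l) (G.dampedTransition_nonneg hp _ _ _ _)
      _ = _ := by
        simp_rw [listProduct_cons_apply, Finset.mul_sum, Finset.sum_mul, mul_assoc]
        exact Finset.sum_comm

/-- A Doeblin-type criterion. The increments of the iterate at two states are bounded by averages
with respect to rows of products along two unrelated lists of policies, so that a common
sub-probability vector is required for rows of two different products. -/
theorem isHilbertContraction_iterate (G : ConcurrentGame n A B) (hn : 1 ≤ n) (hp : 0 < G.pMin)
    {k : ℕ} {s : ℝ} (hs : 0 < s)
    (h : ∀ L L' : List ((∀ i, A i) × (∀ i, B i)), L.length = k → L'.length = k →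
      ∀ i i', ∃ c : Fin n → ℝ, ∑ j, c j = s ∧ (∀ j, c j ≤ G.listProduct L i j) ∧
        ∀ j, c j ≤ G.listProduct L' i' j) :
    IsHilbertContraction (1 - s) G.dampedShapley^[k] := by
  have : Nonempty (Fin n) := ⟨⟨0, hn⟩⟩
  refine ⟨?_, by linarith, fun x y => hilbertSeminorm_le fun i i' => ?_⟩
  · -- The rows have sum one, so that the common mass `s` is at most one.
    let L : List ((∀ i, A i) × (∀ i, B i)) :=
      List.replicate k (fun i => Classical.arbitrary (A i), fun i => Classical.arbitrary (B i))
    let i₀ : Fin n := ⟨0, hn⟩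
    obtain ⟨c, rfl, hc, -⟩ := h L L List.length_replicate List.length_replicate i₀ i₀
    have := Finset.sum_le_sum fun j (_ : j ∈ Finset.univ) => hc j
    rw [G.listProduct_sum] at this
    linarith
  · obtain ⟨L, hL, h1⟩ := G.exists_iterate_sub_le hp k x y
    obtain ⟨L', hL', h2⟩ := G.exists_iterate_sub_le hp k y x
    obtain ⟨c, rfl, hc, hc'⟩ := h L L' hL hL' i i'
    have h3 := sum_mul_sub_sum_mul_le (G.listProduct_sum L i) (G.listProduct_sum L' i') hc hc'
      (x - y)
    have h4 : ∑ j, G.listProduct L' i' j * (y j - x j) =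
        -∑ j, G.listProduct L' i' j * (x - y) j := by
      rw [← Finset.sum_neg_distrib]
      exact Finset.sum_congr rfl fun j _ => by rw [Pi.sub_apply]; ring
    have h5 := h1 i
    have h6 := h2 i'
    rw [h4] at h6
    simp only [Pi.sub_apply] at h3 h6 ⊢
    linarith

theorem isHilbertContraction_of_mem_unichainExponents (G : ConcurrentGame n A B) (hn : 1 ≤ n)
    (hp : 0 < G.pMin) {k : ℕ} (hk : k ∈ G.unichainExponents) :
    IsHilbertContraction (1 - G.theta ^ k) G.dampedShapley^[k] := by
  refine G.isHilbertContraction_iterate hn hp (pow_pos (G.theta_pos hp) k) ?_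
  intro L L' hL hL' i i'
  obtain ⟨j, hj, hj'⟩ : ∃ j, 0 < G.listProduct L i j ∧ 0 < G.listProduct L' i' j := by
    simp_rw [← G.mem_accessibleFrom_singleton hp]
    obtain h | ⟨L'', hL'', h, h'⟩ := G.exists_merge hp L L' (hL.trans hL'.symm) {i} {i'}
    · exact h
    · rw [← h, ← h']
      simp_rw [G.mem_accessibleFrom_singleton hp, listProduct_eq_dampedProduct]
      obtain rfl : L''.length = k := hL''.trans hL
      exact hk.2 _ _ i i'
  have hle : ∀ (M : List ((∀ i, A i) × (∀ i, B i))) (m : Fin n), M.length = k →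
      0 < G.listProduct M m j → ∀ l,
      (Pi.single j (G.theta ^ k) : Fin n → ℝ) l ≤ G.listProduct M m l := by
    intro M m hM hpos l
    obtain rfl | hl := eq_or_ne l j
    · rw [Pi.single_eq_same, ← hM]
      exact G.theta_pow_le_listProduct hp M hpos
    · rw [Pi.single_eq_of_ne hl]
      exact G.listProduct_nonneg hp M m l
  exact ⟨Pi.single j (G.theta ^ k), by simp, hle L i hL hj, hle L' i' hL' hj'⟩

theorem isHilbertContraction_of_mem_irreducibleExponents (G : ConcurrentGame n A B) (hn : 1 ≤ n)
    (hp : 0 < G.pMin) {k : ℕ} (hk : k ∈ G.irreducibleExponents) :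
    IsHilbertContraction (1 - n * G.theta ^ k) G.dampedShapley^[k] := by
  refine G.isHilbertContraction_iterate hn hp
    (mul_pos (by exact_mod_cast hn) (pow_pos (G.theta_pos hp) k)) ?_
  have hle : ∀ M : List ((∀ i, A i) × (∀ i, B i)), M.length = k → ∀ i j,
      G.theta ^ k ≤ G.listProduct M i j := by
    rintro M rfl i j
    refine G.theta_pow_le_listProduct hp M ?_
    rw [listProduct_eq_dampedProduct]
    exact hk.2 _ _ i j
  intro L L' hL hL' i i'
  exact ⟨fun _ => G.theta ^ k, by simp, hle L hL i, hle L' hL' i'⟩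

end Contraction

end ConcurrentGame

end ConcurrentGames

theorem mainTheorem1 {n : ℕ} (hn : 1 ≤ n) (A : Fin n → Type u) (B : Fin n → Type v)
    [∀ i, TopologicalSpace (A i)] [∀ i, CompactSpace (A i)] [∀ i, T2Space (A i)]
    [∀ i, Nonempty (A i)] [∀ i, MeasurableSpace (A i)] [∀ i, BorelSpace (A i)]
    [∀ i, TopologicalSpace (B i)] [∀ i, CompactSpace (B i)] [∀ i, T2Space (B i)]
    [∀ i, Nonempty (B i)] [∀ i, MeasurableSpace (B i)] [∀ i, BorelSpace (B i)]
    (G : ConcurrentGames.ConcurrentGame n A B) (hp : 0 < G.pMin) :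
    (G.IsUnichain →
      G.kUni ∈ G.unichainExponents ∧
      ConcurrentGames.IsHilbertContraction (1 - G.theta ^ G.kUni) G.dampedShapley^[G.kUni]) ∧
    (G.IsIrreducible →
      G.kIrr ∈ G.irreducibleExponents ∧
      ConcurrentGames.IsHilbertContraction (1 - n * G.theta ^ G.kIrr)
        G.dampedShapley^[G.kIrr]) :=
  ⟨fun hG => ⟨hG.kUni_mem hn hp,
    G.isHilbertContraction_of_mem_unichainExponents hn hp (hG.kUni_mem hn hp)⟩,
  fun hG => ⟨hG.kIrr_mem hn hp,
    G.isHilbertContraction_of_mem_irreducibleExponents hn hp (hG.kIrr_mem hn hp)⟩⟩
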